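/- Let $p$ be a prime, $k\ge 1$, $m=p^k$, $r\in\mathbb N$, and let $T=T_{f[-r,r]}$ be the one-dimensional linear cellular automaton on $X=\mathbb Z_m^{\mathbb Z}$ with local rule $$f(x_{-r},\dots,x_r)=\sum_{i=-r}^{r}a_ix_i \pmod{p^k},\qquad (Tx)_n=f(x_{n-r},\dots,x_{n+r}).$$ Assume that $f$ is permutative on both sides: $f$ is permutative in some variable $x_i$ with $i<0$ and in some variable $x_j$ with $j>0$ (permutative in $x_i$ means that, for every choice of the other variables, $x_i\mapsto f(x_{-r},\dots,x_r)$ is a permutation of $\mathbb Z_m$). This holds in particular if $r\ge 1$ and $f$ is permutative in its extreme variables $x_{-r}$ and $x_r$. Put $$P=\{0\}\cup\{j\in\{-r,\dots,r\}:\gcd(a_j,p)=1\},\quad L=\min P,\quad R=\max P,\quad \theta_L=\operatorname{arccot}(-L),\quad \theta_R=\operatorname{arccot}(-R),$$ where $\operatorname{arccot}$ takes values in $(0,\pi)$. Let $\sigma$ be the shift, $(\sigma x)_i=x_{i+1}$, let $\Phi^{(n,t)}=\sigma^nT^t$ for $n\in\mathbb Z$, $t\in\mathbb Z_{\ge 0}$,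 and let $d(x,y)=\sum_{i\in\mathbb Z}|x_i-y_i|\,m^{-|i|}$ with residues represented by $0,\dots,m-1$. For $w\in\mathbb N$, $\tau>0$ and $\theta\in[0,\pi]$ let $$W(w,\tau,\theta)=\{(x+y\cos\theta,\;y\sin\theta): -w<x<w,\ 0<y\le \tau\}.$$ A set $M\subset X$ is $(\varepsilon,W)$-separated if for all distinct $x,\bar x\in M$ there is $(n,t)\in W\cap(\mathbb Z\times\mathbb Z_{\ge0})$ with $d(\Phi^{(n,t)}x,\Phi^{(n,t)}\bar x)\ge\varepsilon$; let $N(\varepsilon,W)$ be the largest cardinality of such a set. The topological directional entropy of $\Phi$ in the direction $(\cos\theta,\sin\theta)$ is $$h_\theta(\Phi)=\lim_{\varepsilon\to0^+}\ \limsup_{w\to\infty}\ \limsup_{\tau\to\infty}\ \frac1\tau\log N(\varepsilon,W(w,\tau,\theta)).$$ Then for every $\theta\in[0,\pi]$ this limit exists, and $$h_\theta(\Phi)=\begin{cases}k\,|\cos\theta+R\sin\theta|\,\log p, & \theta\in[0,\theta_L],\\ k\,|(R-L)\sin\theta|\,\log p, & \theta\in[\theta_L,\theta_R],\\ k\,|\cos\theta+L\sin\theta|\,\log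 p, & \theta\in[\theta_R,\pi].\end{cases}$$ -/

import Mathlib

open Filter Topology

/-- Bi-infinite configurations over the ring `ℤ/m`. -/
abbrev Config (m : ℕ) : Type := ℤ → ZMod m

/-- The neighbourhood `{-r, …, r}`. -/
abbrev Nbhd (r : ℕ) : Type := {j : ℤ // j ∈ Finset.Icc (-(r : ℤ)) (r : ℤ)}

/-- A local rule of radius `r`: a function of the variables `x_{-r}, …, x_r`. -/
abbrev LocalRule (m r : ℕ) : Type := (Nbhd r → ZMod m) → ZMod m

/-- The linear local rule `f(x_{-r}, …, x_r) = ∑ a_i x_i` over `ℤ/m`. -/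
noncomputable def linearRule {m r : ℕ} (a : Nbhd r → ZMod m) : LocalRule m r :=
  fun u => ∑ j, a j * u j

/-- The rule `f` is permutative in the variable `x_j`: for every choice of the other variables,
`x_j ↦ f(x_{-r}, …, x_r)` is a permutation of the alphabet. -/
def IsPermutativeIn {m r : ℕ} (f : LocalRule m r) (j : Nbhd r) : Prop :=
  ∀ u : Nbhd r → ZMod m, Function.Bijective fun s : ZMod m => f (Function.update u j s)

/-- The one-dimensional cellular automaton `(T x)_n = f(x_{n-r}, …, x_{n+r})`. -/
def cellularAutomaton {m r : ℕ} (f : LocalRule m r) : Config m → Config m :=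
  fun x n => f fun j => x (n + j)

/-- The power `σ^n` of the shift, `(σ^n x)_i = x_{i+n}`. -/
def shiftPow {m : ℕ} (n : ℤ) : Config m → Config m :=
  fun x i => x (i + n)

/-- The action `Φ^{(n,t)} = σ^n ∘ T^t` of `ℤ × ℤ₊` generated by the shift and `T`. -/
def shiftAction {m : ℕ} (T : Config m → Config m) (n : ℤ) (t : ℕ) : Config m → Config m :=
  fun x => shiftPow n (T^[t] x)

/-- The metric `d(x, y) = ∑_{i ∈ ℤ} |x_i - y_i| / m^{|i|}`, where residues are represented
by `0, …, m - 1`. (The series converges for `m ≥ 2`.) -/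
noncomputable def configDist {m : ℕ} (x y : Config m) : ℝ :=
  ∑' i : ℤ, |((x i).val : ℝ) - ((y i).val : ℝ)| / (m : ℝ) ^ i.natAbs

/-- The window
`W(w, τ, θ) = {(x + y cos θ, y sin θ) : -w < x < w, 0 < y ≤ τ}` in the space-time plane. -/
def window (w : ℕ) (τ θ : ℝ) : Set (ℝ × ℝ) :=
  {q | ∃ x y : ℝ, -(w : ℝ) < x ∧ x < w ∧ 0 < y ∧ y ≤ τ ∧
    q = (x + y * Real.cos θ, y * Real.sin θ)}

/-- `M` is `(ε, W)`-separated: any two distinct points of `M` have images at distance at least `ε`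
under `Φ^{(n,t)}` for some lattice point `(n, t)` of `W`. -/
def IsWindowSeparated {m : ℕ} (T : Config m → Config m) (ε : ℝ) (W : Set (ℝ × ℝ))
    (M : Set (Config m)) : Prop :=
  M.Pairwise fun x y => ∃ (n : ℤ) (t : ℕ), ((n : ℝ), (t : ℝ)) ∈ W ∧
    ε ≤ configDist (shiftAction T n t x) (shiftAction T n t y)

/-- `N(ε, W)`: the largest cardinality of an `(ε, W)`-separated set. -/
noncomputable def separatedNumber {m : ℕ} (T : Config m → Config m) (ε : ℝ)
    (W : Set (ℝ × ℝ)) : ℕ∞ :=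
  ⨆ (M : Set (Config m)) (_ : IsWindowSeparated T ε W M), M.encard

/-- `limsup_{w → ∞} limsup_{τ → ∞} (1/τ) log N(ε, W(w, τ, θ))`, as an extended real number. -/
noncomputable def directionalEntropyAtScale {m : ℕ} (T : Config m → Config m)
    (θ ε : ℝ) : EReal :=
  limsup (fun w : ℕ =>
    limsup (fun τ : ℝ =>
      ENNReal.log (separatedNumber T ε (window w τ θ) : ENNReal) / (τ : EReal)) atTop) atTop

/-- The topological directional entropy, in the direction `(cos θ, sin θ)`, of the action generated
by the shift and `T` exists (as a limit for `ε → 0+`) and equals `h`. -/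
def HasDirectionalEntropy {m : ℕ} (T : Config m → Config m) (θ h : ℝ) : Prop :=
  Tendsto (fun ε : ℝ => directionalEntropyAtScale T θ ε) (𝓝[>] 0) (𝓝 (h : EReal))

/-- The set `P = {0} ∪ {j : gcd(a_j, p) = 1}` of positions. -/
def unitPositions {m r : ℕ} (p : ℕ) (a : Nbhd r → ZMod m) : Set ℤ :=
  {0} ∪ {j : ℤ | ∃ i : Nbhd r, (i : ℤ) = j ∧ Nat.gcd (a i).val p = 1}

/-- The inverse cotangent with values in `(0, π)`. -/
noncomputable def arccot (x : ℝ) : ℝ := Real.pi / 2 - Real.arctan x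

/-! ### Comparing the metric with agreement on finite blocks. -/

section Metric

/-! All three cases are sign cases of one formula, `hasDirectionalEntropy_max`: the entropy is `k
log p` times `max 0 (cos θ + R sin θ) + max 0 (-(cos θ + L sin θ))`, the growth rate of the interval
of initial coordinates that the window sees.

Upper bound (`separatedNumber_le`): coefficients outside `[L, R]` are divisible by `p`, and a
product of `k` of them vanishes. Hence `T ^ t` depends only on `[L t - r k, R t + r k]`, an excess
bounded in `t`, and a separated set injects into the words on an interval of length `τ h + O(1)` for
fixed `w` and `ε`, where `h` is the above sum.

Lower bound (`le_separatedNumber`): if the window misses a nonzero difference, it misses a nonzero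
`p`-torsion multiple of it. On `p`-torsion only unit coefficients act, so the neighbourhood is
exactly `[L, R]` with invertible end coefficients. Zeros on the strip then propagate sideways,
backwards in time, and fill the interval (`eq_zero_of_strip_eq_zero`). -/

lemma summable_div_pow_natAbs {m : ℕ} (hm : 2 ≤ m) (c : ℝ) :
    Summable fun i : ℤ => c / (m : ℝ) ^ i.natAbs := by
  have h1 : (1 : ℝ) < m := by exact_mod_cast hm
  have h : Summable fun n : ℕ => c * ((m : ℝ)⁻¹) ^ n :=
    (summable_geometric_of_lt_one (by positivity) (inv_lt_one_of_one_lt₀ h1)).mul_left c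
  rw [summable_int_iff_summable_nat_and_neg]
  constructor <;> simpa [div_eq_mul_inv] using h

lemma configDist_term_le {m : ℕ} (hm : 2 ≤ m) (x y : Config m) (i : ℤ) :
    |((x i).val : ℝ) - ((y i).val : ℝ)| / (m : ℝ) ^ i.natAbs ≤ m / (m : ℝ) ^ i.natAbs := by
  have : NeZero m := ⟨by omega⟩
  gcongr
  have hx : ((x i).val : ℝ) ≤ m := by exact_mod_cast (ZMod.val_lt (x i)).le
  have hy : ((y i).val : ℝ) ≤ m := by exact_mod_cast (ZMod.val_lt (y i)).le
  rw [abs_le]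
  constructor <;> linarith [Nat.cast_nonneg (α := ℝ) (x i).val, Nat.cast_nonneg (α := ℝ) (y i).val]

lemma summable_configDist {m : ℕ} (hm : 2 ≤ m) (x y : Config m) :
    Summable fun i : ℤ => |((x i).val : ℝ) - ((y i).val : ℝ)| / (m : ℝ) ^ i.natAbs :=
  (summable_div_pow_natAbs hm m).of_nonneg_of_le (fun i => by positivity)
    (configDist_term_le hm x y)

lemma one_le_configDist {m : ℕ} (hm : 2 ≤ m) {x y : Config m} (h : x 0 ≠ y 0) :
    1 ≤ configDist x y := by
  have : NeZero m := ⟨by omega⟩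
  have hle := (summable_configDist hm x y).le_tsum 0 fun j _ => by positivity
  refine le_trans ?_ hle
  have hne : (((x 0).val : ℤ) - ((y 0).val : ℤ)) ≠ 0 := by
    intro h0
    exact h (ZMod.val_injective m (by omega))
  have := Int.one_le_abs hne
  simp only [Int.natAbs_zero, pow_zero, div_one]
  exact_mod_cast this

lemma exists_configDist_lt {m : ℕ} (hm : 2 ≤ m) {ε : ℝ} (hε : 0 < ε) :
    ∃ K : ℕ, ∀ x y : Config m, (∀ i : ℤ, |i| ≤ K → x i = y i) → configDist x y < ε := by
  have ht := tendsto_tsum_compl_atTop_zero fun i : ℤ => (m : ℝ) / (m : ℝ) ^ i.natAbs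
  obtain ⟨s, hs⟩ := ((tendsto_order.1 ht).2 ε hε).exists
  refine ⟨s.sup Int.natAbs, fun x y hxy => lt_of_le_of_lt ?_ hs⟩
  have hsupp : Function.support
      (fun i : ℤ => |((x i).val : ℝ) - ((y i).val : ℝ)| / (m : ℝ) ^ i.natAbs) ⊆ {i | i ∉ s} := by
    intro i hi his
    apply hi
    have : i.natAbs ≤ s.sup Int.natAbs := Finset.le_sup (f := Int.natAbs) his
    simp [hxy i (by rw [Int.abs_eq_natAbs]; exact_mod_cast this)]
  unfold configDist
  rw [← tsum_subtype_eq_of_support_subset hsupp]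
  exact Summable.tsum_le_tsum (fun i => configDist_term_le hm x y i)
    ((summable_configDist hm x y).subtype _) ((summable_div_pow_natAbs hm m).subtype _)

end Metric

/-! ### Linear rules over `ZMod (p ^ k)` and their effective neighbourhood. -/

section LinearRules

variable {m r : ℕ}

/-- The cellular automaton of a linear rule, as a linear map. -/
noncomputable def linearAutomaton (a : Nbhd r → ZMod m) : Config m →ₗ[ZMod m] Config m where
  toFun := cellularAutomaton (linearRule a)
  map_add' x y := by
    funext n
    simp [cellularAutomaton, linearRule, mul_add, Finset.sum_add_distrib]
  map_smul' c x := by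
    funext n
    simp only [cellularAutomaton, linearRule, Pi.smul_apply, smul_eq_mul, RingHom.id_apply,
      Finset.mul_sum]
    exact Finset.sum_congr rfl fun j _ => by ring

lemma linearAutomaton_apply (a : Nbhd r → ZMod m) (x : Config m) (n : ℤ) :
    linearAutomaton a x n = ∑ j : Nbhd r, a j * x (n + j) := rfl

lemma iterate_cellularAutomaton (a : Nbhd r → ZMod m) (t : ℕ) :
    (cellularAutomaton (linearRule a))^[t] = ⇑(linearAutomaton a ^ t) := by
  rw [Module.End.coe_pow]; rfl

lemma linearAutomaton_add (a b : Nbhd r → ZMod m) :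
    linearAutomaton (a + b) = linearAutomaton a + linearAutomaton b := by
  ext x n
  simp [linearAutomaton_apply, add_mul, Finset.sum_add_distrib]

lemma isUnit_of_isPermutativeIn {a : Nbhd r → ZMod m} {i : Nbhd r}
    (h : IsPermutativeIn (linearRule a) i) : IsUnit (a i) := by
  obtain ⟨s, hs⟩ := (h 0).2 1
  refine IsUnit.of_mul_eq_one s ?_
  simp only [linearRule] at hs
  rw [Finset.sum_eq_single i] at hs
  · simpa using hs
  · intro j _ hj
    simp [Function.update_of_ne hj]
  · simp

lemma gcd_val_eq_one_iff_isUnit {p k : ℕ} (hp : p.Prime) (hk : 1 ≤ k) (b : ZMod (p ^ k)) :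
    Nat.gcd b.val p = 1 ↔ IsUnit b := by
  have : NeZero (p ^ k) := ⟨(pow_pos hp.pos k).ne'⟩
  conv_rhs => rw [← ZMod.natCast_zmod_val b]
  rw [ZMod.isUnit_iff_coprime, Nat.coprime_pow_right_iff (by omega)]

lemma dvd_of_not_isUnit {p k : ℕ} (hp : p.Prime) (hk : 1 ≤ k) {b : ZMod (p ^ k)}
    (hb : ¬ IsUnit b) : (p : ZMod (p ^ k)) ∣ b := by
  have : NeZero (p ^ k) := ⟨(pow_pos hp.pos k).ne'⟩
  rw [← gcd_val_eq_one_iff_isUnit hp hk] at hb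
  have h : p ∣ b.val := by
    by_contra h
    exact hb (Nat.coprime_comm.1 ((Nat.Prime.coprime_iff_not_dvd hp).2 h))
  rw [← ZMod.natCast_zmod_val b]
  exact Nat.cast_dvd_cast h

lemma natCast_pow_smul_eq_zero {p k : ℕ} (z : Config (p ^ k)) :
    (p : ZMod (p ^ k)) ^ k • z = 0 := by
  have : (p : ZMod (p ^ k)) ^ k = 0 := by exact_mod_cast ZMod.natCast_self (p ^ k)
  rw [this, zero_smul]

/-- If all coefficients outside `[L, R]` are divisible by `q`, then on `q ^ e`-torsion
configurations `T ^ t` has the neighbourhood `[L t - r e, R t + r e]`. -/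
lemma pow_linearAutomaton_apply_eq_zero {a : Nbhd r → ZMod m} {q : ZMod m} {L R : ℤ}
    (hL : L ≤ 0) (hR : 0 ≤ R) (ha : ∀ j : Nbhd r, ((j : ℤ) < L ∨ R < j) → q ∣ a j) (t : ℕ) :
    ∀ (e : ℕ) (z : Config m) (n : ℤ), q ^ e • z = 0 →
      (∀ i, n + L * t - r * e ≤ i → i ≤ n + R * t + r * e → z i = 0) →
      (linearAutomaton a ^ t) z n = 0 := by
  induction t with
  | zero =>
    intro e z n _ hz
    have : (0 : ℤ) ≤ r * e := by positivity
    exact hz n (by simpa using this) (by simpa using this)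
  | succ t ih =>
    intro e z n hq hz
    rcases e with _ | e
    · have : z = 0 := by simpa using hq
      simp [this]
    classical
    -- One step splits in two: `b` moves within `[L, R]` and keeps the torsion exponent; `c` may
    -- move by `r` but is divisible by `q`, so it lowers the exponent and pays for the excess.
    let b : Nbhd r → ZMod m := fun j => if (j : ℤ) < L ∨ R < j then 0 else a j
    let c : Nbhd r → ZMod m := fun j => if (j : ℤ) < L ∨ R < j then a j else 0
    have hab : a = b + c := by
      funext j
      by_cases h : (j : ℤ) < L ∨ R < j <;> simp [b, c, h]
    have hz' : linearAutomaton a z = linearAutomaton b z + linearAutomaton c z := by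
      conv_lhs => rw [hab, linearAutomaton_add]
      rfl
    rw [pow_succ, Module.End.mul_apply, hz', map_add, Pi.add_apply]
    have hre : (0 : ℤ) ≤ r * e := by positivity
    push_cast at hz
    rw [ih (e + 1), ih e, add_zero]
    · have hc : linearAutomaton c z = q • linearAutomaton
          (fun j => if h : (j : ℤ) < L ∨ R < j then (ha j h).choose else 0) z := by
        funext i
        rw [Pi.smul_apply, linearAutomaton_apply, linearAutomaton_apply, smul_eq_mul,
          Finset.mul_sum]
        refine Finset.sum_congr rfl fun j _ => ?_
        by_cases h : (j : ℤ) < L ∨ R < j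
        · simp only [c, h, if_true, dif_pos]
          rw [← mul_assoc, ← (ha j h).choose_spec]
        · simp [c, h]
      rw [hc, smul_smul, ← pow_succ, ← map_smul, hq, map_zero]
    · intro i h1 h2
      rw [linearAutomaton_apply]
      refine Finset.sum_eq_zero fun j _ => ?_
      have hj := Finset.mem_Icc.1 j.2
      rw [hz _ (by linarith) (by linarith), mul_zero]
    · rw [← map_smul, hq, map_zero]
    · intro i h1 h2
      push_cast at h1 h2
      rw [linearAutomaton_apply]
      refine Finset.sum_eq_zero fun j _ => ?_
      by_cases h : (j : ℤ) < L ∨ R < j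
      · simp [b, h]
      · push Not at h
        rw [hz _ (by linarith) (by linarith), mul_zero]

lemma eq_zero_of_linearAutomaton_apply_eq_zero {a : Nbhd r → ZMod m} {z : Config m} {n : ℤ}
    (j₀ : Nbhd r) (hu : IsUnit (a j₀)) (h : ∀ j : Nbhd r, j ≠ j₀ → a j * z (n + j) = 0)
    (hz : linearAutomaton a z n = 0) : z (n + j₀) = 0 := by
  rw [linearAutomaton_apply, Finset.sum_eq_single j₀ (fun j _ hj => h j hj) (by simp)] at hz
  exact hu.mul_right_eq_zero.1 hz

end LinearRules

/-! ### Propagation of zeros away from a strip. -/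

section Propagation

/-- Zeros on a strip of slope `v` propagate to the right, backwards in time, if the rightmost
cell of the neighbourhood `[L, R]` is determined by the other ones and the image. -/
lemma zero_propagates_right {A : Type*} [Zero A] {y : ℕ → ℤ → A} {L R : ℤ} {v w : ℝ} {τ : ℕ}
    (H : ∀ t n, y (t + 1) n = 0 → (∀ j, L ≤ j → j < R → y t (n + j) = 0) → y t (n + R) = 0)
    (hstrip : ∀ t : ℕ, 1 ≤ t → t ≤ τ → ∀ n : ℤ, t * v - w < n → n < t * v + w → y t n = 0)
    (h1 : (R : ℝ) - L < 2 * w) (h2 : v + R < 2 * w) (i : ℕ) :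
    ∀ t : ℕ, t + i = τ → 1 ≤ t → ∀ n : ℤ, t * v - w < n →
      (n : ℝ) < t * v + w + i * max 0 (v + R) → y t n = 0 := by
  induction i with
  | zero =>
    intro t ht ht1 n hn hn'
    exact hstrip t ht1 (by omega) n hn (by simpa using hn')
  | succ i ih =>
    intro t ht ht1
    -- Within row `t` cells are swept from left to right, starting at the left edge of the strip.
    suffices key : ∀ (N : ℕ) (n : ℤ), n < ⌊t * v - w⌋ + N → t * v - w < n →
        (n : ℝ) < t * v + w + (i + 1 : ℕ) * max 0 (v + R) → y t n = 0 by
      intro n hn hn'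
      exact key ((n - ⌊t * v - w⌋).toNat + 1) n (by push_cast; have := Int.self_le_toNat (n - ⌊t * v - w⌋); linarith) hn hn'
    intro N
    induction N with
    | zero =>
      intro n hn hn'
      have := Int.floor_le (t * v - w)
      have h : (n : ℝ) < ⌊t * v - w⌋ := by exact_mod_cast (by simpa using hn)
      linarith
    | succ N ihN =>
      intro n hN hn hn'
      by_cases hs : (n : ℝ) < t * v + w
      · exact hstrip t ht1 (by omega) n hn hs
      push Not at hs
      have hpos : 0 < v + R := by
        by_contra hneg
        rw [max_eq_left (not_lt.1 hneg)] at hn'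
        linarith
      rw [max_eq_right hpos.le] at hn' ih ihN
      push_cast at hn' hN
      -- Cell `n` follows from cell `n - R` of row `t + 1` and from earlier cells of row `t`;
      -- relative to the strip, this gains `v + R` per row.
      have := H t (n - R) (ih (t + 1) (by omega) (by omega) (n - R)
        (by push_cast; linarith) (by push_cast; linarith)) fun j hj1 hj2 => by
          have hj1' : (L : ℝ) ≤ j := by exact_mod_cast hj1
          have hj2' : (j : ℝ) < R := by exact_mod_cast hj2
          exact ihN _ (by omega) (by push_cast; linarith) (by push_cast; linarith)
      simpa using this

/-- The reflection `n ↦ -n` exchanges `(L, R, v)` with `(-R, -L, -v)`. -/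
lemma zero_propagates_left {A : Type*} [Zero A] {y : ℕ → ℤ → A} {L R : ℤ} {v w : ℝ} {τ : ℕ}
    (H : ∀ t n, y (t + 1) n = 0 → (∀ j, L < j → j ≤ R → y t (n + j) = 0) → y t (n + L) = 0)
    (hstrip : ∀ t : ℕ, 1 ≤ t → t ≤ τ → ∀ n : ℤ, t * v - w < n → n < t * v + w → y t n = 0)
    (h1 : (R : ℝ) - L < 2 * w) (h2 : -(v + L) < 2 * w) {i t : ℕ} (hti : t + i = τ) (ht : 1 ≤ t)
    {n : ℤ} (hn : t * v - w - i * max 0 (-(v + L)) < n) (hn' : (n : ℝ) < t * v + w) :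
    y t n = 0 := by
  have := zero_propagates_right (y := fun t n => y t (-n)) (L := -R) (R := -L) (v := -v) (w := w)
    (τ := τ) (fun t n h0 h => by
      have := H t (-n) h0 fun j hj1 hj2 => by
        simpa [neg_add, add_comm] using h (-j) (by omega) (by omega)
      simpa [neg_add, add_comm] using this)
    (fun t ht1 ht2 n hn hn' => hstrip t ht1 ht2 (-n) (by push_cast; linarith)
      (by push_cast; linarith))
    (by push_cast; linarith) (by push_cast; linarith) i t hti ht (-n)
    (by push_cast; linarith) (by
      have e : -v + ((-L : ℤ) : ℝ) = -(v + L) := by push_cast; ring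
      rw [e]; push_cast; linarith)
  simpa using this

end Propagation

/-! ### From dependence intervals to bounds on separated sets. -/

section Counting

variable {p k r : ℕ}

lemma two_le_prime_pow (hp : p.Prime) (hk : 1 ≤ k) : 2 ≤ p ^ k :=
  hp.two_le.trans (Nat.le_self_pow (by omega) p)

lemma separatedNumber_le (hp : p.Prime) (hk : 1 ≤ k) {a : Nbhd r → ZMod (p ^ k)} {L R : ℤ}
    (hL : L ≤ 0) (hR : 0 ≤ R)
    (ha : ∀ j : Nbhd r, ((j : ℤ) < L ∨ R < j) → ¬ IsUnit (a j)) (θ : ℝ) {ε : ℝ} (hε : 0 < ε) :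
    ∃ C : ℝ, ∀ (w : ℕ) (τ : ℝ), 0 ≤ τ → ∃ N : ℕ,
      N ≤ τ * (max 0 (Real.cos θ + R * Real.sin θ) + max 0 (-(Real.cos θ + L * Real.sin θ)))
        + 2 * w + C ∧
      separatedNumber (cellularAutomaton (linearRule a)) ε (window w τ θ) ≤
        (((p ^ k) ^ N : ℕ) : ℕ∞) := by
  have : NeZero (p ^ k) := ⟨(pow_pos hp.pos k).ne'⟩
  -- `K` is the radius visible at scale `ε` and `r k` the excess of the neighbourhood; each counts
  -- on both sides of the interval, and rounding costs at most 3.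
  obtain ⟨K, hK⟩ := exists_configDist_lt (two_le_prime_pow hp hk) hε
  refine ⟨2 * (K + r * k) + 3, fun w τ hτ => ?_⟩
  set α := max 0 (-(Real.cos θ + L * Real.sin θ)) with hα
  set β := max 0 (Real.cos θ + R * Real.sin θ) with hβ
  have hα0 : 0 ≤ α := le_max_left _ _
  have hβ0 : 0 ≤ β := le_max_left _ _
  have hα1 : -(Real.cos θ + L * Real.sin θ) ≤ α := le_max_right _ _
  have hβ1 : Real.cos θ + R * Real.sin θ ≤ β := le_max_right _ _
  set A := ⌊-(w : ℝ) - K - r * k - τ * α⌋ with hA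
  set B := ⌈(w : ℝ) + K + r * k + τ * β⌉ with hB
  have hA1 : (A : ℝ) ≤ -(w : ℝ) - K - r * k - τ * α := Int.floor_le _
  have hA2 := Int.lt_floor_add_one (-(w : ℝ) - K - r * k - τ * α)
  have hB1 : (w : ℝ) + K + r * k + τ * β ≤ B := Int.le_ceil _
  have hB2 := Int.ceil_lt_add_one ((w : ℝ) + K + r * k + τ * β)
  rw [← hA] at hA2
  rw [← hB] at hB2
  have hAB : (A : ℝ) ≤ B := by
    have : 0 ≤ τ * α := by positivity
    have : 0 ≤ τ * β := by positivity
    have : (0 : ℝ) ≤ w + K + r * k := by positivity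
    linarith
  have hAB' : A ≤ B := by exact_mod_cast hAB
  refine ⟨(Finset.Icc A B).card, ?_, ?_⟩
  · have : (((Finset.Icc A B).card : ℤ) : ℝ) = B + 1 - A := by
      rw [Int.card_Icc_of_le _ _ (by omega)]
      push_cast; ring
    rw [Int.cast_natCast] at this
    rw [this]
    linarith
  · refine iSup₂_le fun M hM => ?_
    let res : Config (p ^ k) → (Finset.Icc A B → ZMod (p ^ k)) := fun x i => x i
    have hinj : Set.InjOn res M := by
      intro x hx y hy hxy
      by_contra hne
      obtain ⟨n, t, ⟨u, v, hu1, hu2, hv1, hv2, hq⟩, hd⟩ := hM hx hy hne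
      rw [Prod.mk.injEq] at hq
      refine absurd hd (not_le.2 (hK _ _ fun i hi => ?_))
      have hi' := abs_le.1 hi
      have hi1 : -(K : ℝ) ≤ i := by exact_mod_cast hi'.1
      have hi2 : (i : ℝ) ≤ K := by exact_mod_cast hi'.2
      have hv1' : v * -(Real.cos θ + L * Real.sin θ) ≤ τ * α :=
        (mul_le_mul_of_nonneg_left hα1 hv1.le).trans (mul_le_mul_of_nonneg_right hv2 hα0)
      have hv2' : v * (Real.cos θ + R * Real.sin θ) ≤ τ * β :=
        (mul_le_mul_of_nonneg_left hβ1 hv1.le).trans (mul_le_mul_of_nonneg_right hv2 hβ0)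
      have hz := pow_linearAutomaton_apply_eq_zero (q := (p : ZMod (p ^ k))) hL hR
        (fun j hj => dvd_of_not_isUnit hp hk (ha j hj)) t k (x - y) (i + n)
        (natCast_pow_smul_eq_zero _) fun l hl1 hl2 => by
          have hl1' : (i + n + L * t - r * k : ℝ) ≤ l := by exact_mod_cast hl1
          have hl2' : (l : ℝ) ≤ i + n + R * t + r * k := by exact_mod_cast hl2
          rw [hq.1, hq.2] at hl1' hl2'
          have h1 : (A : ℝ) ≤ l := by linarith
          have h2 : (l : ℝ) ≤ B := by linarith
          have := congrFun hxy ⟨l, Finset.mem_Icc.2 ⟨by exact_mod_cast h1, by exact_mod_cast h2⟩⟩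
          exact sub_eq_zero.2 this
      rw [map_sub] at hz
      have := sub_eq_zero.1 hz
      simpa [shiftAction, shiftPow, iterate_cellularAutomaton] using this
    calc M.encard ≤ (Set.univ : Set (Finset.Icc A B → ZMod (p ^ k))).encard :=
          Set.encard_le_encard_of_injOn (fun _ _ => Set.mem_univ _) hinj
      _ = _ := by
          rw [Set.encard_univ, ENat.card_eq_coe_fintype_card]
          simp [ZMod.card]

/-- The multiplier is `p ^ (e - 1)`, with `e` the least exponent such that `p ^ e` kills `z`. -/
lemma exists_torsion_multiple {z : Config (p ^ k)} (hz : z ≠ 0) :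
    ∃ c : ZMod (p ^ k), c • z ≠ 0 ∧ (p : ZMod (p ^ k)) • (c • z) = 0 := by
  classical
  have hex : ∃ e, (p : ZMod (p ^ k)) ^ e • z = 0 := ⟨k, natCast_pow_smul_eq_zero z⟩
  have h0 : Nat.find hex ≠ 0 := by
    intro h
    have := Nat.find_spec hex
    rw [h] at this
    exact hz (by simpa using this)
  refine ⟨(p : ZMod (p ^ k)) ^ (Nat.find hex - 1), Nat.find_min hex (by omega), ?_⟩
  rw [smul_smul, ← pow_succ', Nat.sub_add_cancel (by omega)]
  exact Nat.find_spec hex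

/-- A window that sees every nonzero `p`-torsion configuration supported in `J` separates all
configurations supported in `J`. -/
lemma le_separatedNumber (hp : p.Prime) (hk : 1 ≤ k) {a : Nbhd r → ZMod (p ^ k)} {ε : ℝ}
    (hε : ε ≤ 1) {W : Set (ℝ × ℝ)} (J : Finset ℤ)
    (h : ∀ z : Config (p ^ k), (p : ZMod (p ^ k)) • z = 0 → (∀ i ∉ J, z i = 0) →
      (∀ (n : ℤ) (t : ℕ), ((n : ℝ), (t : ℝ)) ∈ W → (linearAutomaton a ^ t) z n = 0) → z = 0) :
    (((p ^ k) ^ J.card : ℕ) : ℕ∞) ≤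
      separatedNumber (cellularAutomaton (linearRule a)) ε W := by
  classical
  have : NeZero (p ^ k) := ⟨(pow_pos hp.pos k).ne'⟩
  let ext : (J → ZMod (p ^ k)) → Config (p ^ k) := fun u i => if hi : i ∈ J then u ⟨i, hi⟩ else 0
  have hinj : Function.Injective ext := by
    intro u v huv
    funext i
    have := congrFun huv i
    simpa [ext] using this
  have hsep : IsWindowSeparated (cellularAutomaton (linearRule a)) ε W (Set.range ext) := by
    rintro _ ⟨u, rfl⟩ _ ⟨v, rfl⟩ hne
    by_contra hcon
    push Not at hcon
    -- Distances below `ε ≤ 1` force equal central coordinates, so the orbit of the difference, and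
    -- of its torsion multiple, vanishes on the window.
    obtain ⟨c, hc1, hc2⟩ := exists_torsion_multiple (sub_ne_zero.2 hne)
    refine hc1 (h _ hc2 (fun i hi => ?_) fun n t hnt => ?_)
    · simp [ext, hi]
    · have hd := hcon n t hnt
      have h0 : (linearAutomaton a ^ t) (ext u) n = (linearAutomaton a ^ t) (ext v) n := by
        by_contra hne'
        refine absurd hd (not_lt.2 (hε.trans (one_le_configDist (two_le_prime_pow hp hk) ?_)))
        simpa [shiftAction, shiftPow, iterate_cellularAutomaton] using hne'
      rw [map_smul, map_sub, Pi.smul_apply, Pi.sub_apply, h0, sub_self, smul_zero]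
  calc (((p ^ k) ^ J.card : ℕ) : ℕ∞) = ENat.card (J → ZMod (p ^ k)) := by
        rw [ENat.card_eq_coe_fintype_card]
        simp [ZMod.card]
    _ ≤ (Set.range ext).encard := hinj.encard_range
    _ ≤ _ := le_iSup₂_of_le (Set.range ext) hsep le_rfl

lemma mul_eq_zero_of_torsion (hp : p.Prime) (hk : 1 ≤ k) {b : ZMod (p ^ k)} (hb : ¬ IsUnit b)
    {z : Config (p ^ k)} (hz : (p : ZMod (p ^ k)) • z = 0) (n : ℤ) : b * z n = 0 := by
  obtain ⟨c, rfl⟩ := dvd_of_not_isUnit hp hk hb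
  have := congrFun hz n
  simp only [Pi.smul_apply, smul_eq_mul, Pi.zero_apply] at this
  rw [mul_right_comm, this, zero_mul]

end Counting

/-! ### Reconstruction of torsion configurations from a strip. -/

section LowerBound

variable {p k r : ℕ}

/-- A strip of slope `v` sees every nonzero `p`-torsion configuration supported in the interval
spanned by the backward light cones of the strip. -/
lemma eq_zero_of_strip_eq_zero (hp : p.Prime) (hk : 1 ≤ k) {a : Nbhd r → ZMod (p ^ k)}
    (l ρ : Nbhd r) (hl : IsUnit (a l)) (hρ : IsUnit (a ρ))
    (ha : ∀ j : Nbhd r, ((j : ℤ) < l ∨ (ρ : ℤ) < j) → ¬ IsUnit (a j)) {v w : ℝ} {τ : ℕ}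
    (hτ : 1 ≤ τ) (h1 : ((ρ : ℤ) : ℝ) - (l : ℤ) < 2 * w) (h2 : v + (ρ : ℤ) < 2 * w)
    (h3 : -(v + (l : ℤ)) < 2 * w)
    (h4 : v + max 0 (-(v + (l : ℤ))) + (ρ : ℤ) < w)
    (h5 : max 0 (v + (ρ : ℤ)) - (v + (ρ : ℤ)) < w)
    {z : Config (p ^ k)} (hz : (p : ZMod (p ^ k)) • z = 0)
    (hsupp : ∀ i : ℤ, ((i : ℝ) < -(τ * max 0 (-(v + (l : ℤ)))) ∨
      τ * max 0 (v + (ρ : ℤ)) < i) → z i = 0)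
    (hstrip : ∀ t : ℕ, 1 ≤ t → t ≤ τ → ∀ n : ℤ, t * v - w < n → n < t * v + w →
      (linearAutomaton a ^ t) z n = 0) : z = 0 := by
  have htor : ∀ t, (p : ZMod (p ^ k)) • (linearAutomaton a ^ t) z = 0 := fun t => by
    rw [← map_smul, hz, map_zero]
  have Hr : ∀ t n, (linearAutomaton a ^ (t + 1)) z n = 0 →
      (∀ j, (l : ℤ) ≤ j → j < ρ → (linearAutomaton a ^ t) z (n + j) = 0) →
      (linearAutomaton a ^ t) z (n + ρ) = 0 := by
    intro t n h0 h
    rw [pow_succ', Module.End.mul_apply] at h0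
    refine eq_zero_of_linearAutomaton_apply_eq_zero ρ hρ (fun j hj => ?_) h0
    by_cases hju : IsUnit (a j)
    · have hj' : ¬ ((j : ℤ) < l ∨ (ρ : ℤ) < j) := fun hc => ha j hc hju
      have hne : (j : ℤ) ≠ ρ := fun hc => hj (Subtype.ext hc)
      rw [h j (by omega) (by omega), mul_zero]
    · exact mul_eq_zero_of_torsion hp hk hju (htor t) _
  have Hl : ∀ t n, (linearAutomaton a ^ (t + 1)) z n = 0 →
      (∀ j, (l : ℤ) < j → j ≤ ρ → (linearAutomaton a ^ t) z (n + j) = 0) →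
      (linearAutomaton a ^ t) z (n + l) = 0 := by
    intro t n h0 h
    rw [pow_succ', Module.End.mul_apply] at h0
    refine eq_zero_of_linearAutomaton_apply_eq_zero l hl (fun j hj => ?_) h0
    by_cases hju : IsUnit (a j)
    · have hj' : ¬ ((j : ℤ) < l ∨ (ρ : ℤ) < j) := fun hc => ha j hc hju
      have hne : (j : ℤ) ≠ l := fun hc => hj (Subtype.ext hc)
      rw [h j (by omega) (by omega), mul_zero]
    · exact mul_eq_zero_of_torsion hp hk hju (htor t) _
  have hτ' : ((τ - 1 : ℕ) : ℝ) = τ - 1 := by push_cast [Nat.cast_sub hτ]; ring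
  -- The strip has no cells at time 0, so two-sided propagation stops at row 1.
  have hone : ∀ n : ℤ, v - w - (τ - 1) * max 0 (-(v + (l : ℤ))) < n →
      (n : ℝ) < v + w + (τ - 1) * max 0 (v + (ρ : ℤ)) → (linearAutomaton a ^ 1) z n = 0 := by
    intro n hn1 hn2
    rcases lt_or_ge (v - w) n with hn | hn
    · refine zero_propagates_right (y := fun t => (linearAutomaton a ^ t) z) Hr hstrip h1 h2
        (τ - 1) 1 (by omega) le_rfl n ?_ ?_
      · simpa using hn
      · rw [hτ']; simpa using hn2
    · have hw : 0 < w := by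
        rcases le_total 0 (v + ((ρ : ℤ) : ℝ)) with h | h
        · linarith
        · rw [max_eq_left h] at h5
          linarith
      refine zero_propagates_left (y := fun t => (linearAutomaton a ^ t) z) Hl hstrip h1 h3
        (i := τ - 1) (t := 1) (by omega) le_rfl (n := n) ?_ ?_
      · rw [hτ']; simpa using hn1
      · push_cast; linarith
  set α := max 0 (-(v + ((l : ℤ) : ℝ))) with hα
  set β := max 0 (v + ((ρ : ℤ) : ℝ)) with hβ
  -- Row 0 is recovered from row 1 by a left-to-right sweep that starts in the zeros left of the
  -- support; `h4` and `h5` keep the required row 1 cells within range.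
  have key : ∀ (N : ℕ) (n : ℤ), n < ⌊-(τ * α)⌋ + N → z n = 0 := by
    intro N
    induction N with
    | zero =>
      intro n hn
      refine hsupp n (Or.inl ?_)
      have h : (n : ℝ) < ⌊-(τ * α)⌋ := by exact_mod_cast (by simpa using hn)
      exact h.trans_le (Int.floor_le _)
    | succ N ih =>
      intro n hn
      by_cases hs : (n : ℝ) < -(τ * α) ∨ τ * β < n
      · exact hsupp n hs
      push Not at hs
      push_cast at hn
      have := Hr 0 (n - ρ) (hone _ (by push_cast; linarith) (by push_cast; linarith))
        fun j hj1 hj2 => ih _ (by omega)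
      simpa using this
  funext n
  refine key ((n - ⌊-(τ * α)⌋).toNat + 1) n ?_
  have := Int.self_le_toNat (n - ⌊-(τ * α)⌋)
  push_cast
  linarith

end LowerBound

/-! ### Growth rates, limits and the sectors of directions. -/

section Entropy

variable {p k r : ℕ}

lemma exists_le_separatedNumber_of_sin_pos (hp : p.Prime) (hk : 1 ≤ k) {a : Nbhd r → ZMod (p ^ k)}
    (l ρ : Nbhd r) (hl : IsUnit (a l)) (hρ : IsUnit (a ρ))
    (ha : ∀ j : Nbhd r, ((j : ℤ) < l ∨ (ρ : ℤ) < j) → ¬ IsUnit (a j)) {θ : ℝ}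
    (hs : 0 < Real.sin θ) {ε : ℝ} (hε : ε ≤ 1) :
    ∃ (w₀ : ℕ) (C τ₀ : ℝ), ∀ w : ℕ, w₀ ≤ w → ∀ τ : ℝ, τ₀ ≤ τ → ∃ N : ℕ,
      τ * (max 0 (Real.cos θ + (ρ : ℤ) * Real.sin θ) +
        max 0 (-(Real.cos θ + (l : ℤ) * Real.sin θ))) - C ≤ N ∧
      (((p ^ k) ^ N : ℕ) : ℕ∞) ≤
        separatedNumber (cellularAutomaton (linearRule a)) ε (window w τ θ) := by
  set s := Real.sin θ with hsdef
  set c := Real.cos θ with hcdef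
  set v := c / s with hv
  have hcv : c = s * v := by rw [hv]; field_simp
  set α := max 0 (-(v + ((l : ℤ) : ℝ))) with hα
  set β := max 0 (v + ((ρ : ℤ) : ℝ)) with hβ
  have hα0 : 0 ≤ α := le_max_left _ _
  have hβ0 : 0 ≤ β := le_max_left _ _
  have hαs : max 0 (-(c + ((l : ℤ) : ℝ) * s)) = s * α := by
    rw [hα, mul_max_of_nonneg _ _ hs.le, mul_zero, hcv]; congr 1; ring
  have hβs : max 0 (c + ((ρ : ℤ) : ℝ) * s) = s * β := by
    rw [hβ, mul_max_of_nonneg _ _ hs.le, mul_zero, hcv]; congr 1; ring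
  obtain ⟨w₀, hw₀⟩ := exists_nat_gt (|v| + |((l : ℤ) : ℝ)| + |((ρ : ℤ) : ℝ)| + α + β)
  -- In row `t` the window is the strip of slope `v = cot θ`. The loss `α + β + 1` comes from
  -- rounding `τ s` and the interval ends; `τ ≥ 1 / s` provides at least one row.
  refine ⟨w₀, α + β + 1, 1 / s, fun w hw τ hτ => ?_⟩
  have hw' : |v| + |((l : ℤ) : ℝ)| + |((ρ : ℤ) : ℝ)| + α + β < w :=
    hw₀.trans_le (by exact_mod_cast hw)
  have hv1 := neg_abs_le v
  have hv2 := le_abs_self v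
  have hl1 := neg_abs_le ((l : ℤ) : ℝ)
  have hl2 := le_abs_self ((l : ℤ) : ℝ)
  have hρ1 := neg_abs_le ((ρ : ℤ) : ℝ)
  have hρ2 := le_abs_self ((ρ : ℤ) : ℝ)
  set n₀ := ⌊τ * s⌋₊ with hn₀
  have hτs : 1 ≤ τ * s := by rwa [div_le_iff₀ hs] at hτ
  have hn1 : 1 ≤ n₀ := Nat.one_le_floor_iff _ |>.2 hτs
  have hn2 : (n₀ : ℝ) ≤ τ * s := Nat.floor_le (by linarith)
  have hn3 : τ * s < n₀ + 1 := Nat.lt_floor_add_one _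
  have hA1 := Int.floor_le (n₀ * α)
  have hA2 := Int.lt_floor_add_one (n₀ * α)
  have hB1 := Int.floor_le (n₀ * β)
  have hB2 := Int.lt_floor_add_one (n₀ * β)
  have hA0 : 0 ≤ ⌊n₀ * α⌋ := Int.floor_nonneg.2 (by positivity)
  have hB0 : 0 ≤ ⌊n₀ * β⌋ := Int.floor_nonneg.2 (by positivity)
  refine ⟨(Finset.Icc (-⌊n₀ * α⌋) ⌊n₀ * β⌋).card, ?_, le_separatedNumber hp hk hε _ ?_⟩
  · have : (((Finset.Icc (-⌊n₀ * α⌋) ⌊n₀ * β⌋).card : ℤ) : ℝ) = ⌊n₀ * β⌋ + 1 + ⌊n₀ * α⌋ := by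
      rw [Int.card_Icc_of_le _ _ (by omega)]
      push_cast; ring
    rw [Int.cast_natCast] at this
    rw [this, hαs, hβs]
    have h : τ * s * (β + α) ≤ (n₀ + 1) * (β + α) :=
      mul_le_mul_of_nonneg_right hn3.le (by linarith)
    linarith
  · intro z hz hsupp hW
    refine eq_zero_of_strip_eq_zero hp hk l ρ hl hρ ha (v := v) (w := w) (τ := n₀) hn1
      (by linarith [abs_nonneg v]) (by linarith [abs_nonneg v]) (by linarith [abs_nonneg v])
      (by linarith [abs_nonneg v]) (by linarith [abs_nonneg v]) hz ?_ ?_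
    · intro i hi
      refine hsupp i fun hmem => ?_
      obtain ⟨h1, h2⟩ := Finset.mem_Icc.1 hmem
      have h1' : (-(⌊n₀ * α⌋ : ℤ) : ℝ) ≤ i := by exact_mod_cast h1
      have h2' : (i : ℝ) ≤ ⌊n₀ * β⌋ := by exact_mod_cast h2
      rcases hi with hi | hi <;> linarith
    · intro t ht1 ht2 n hn hn'
      refine hW n t ⟨n - t * v, t / s, by linarith, by linarith, ?_, ?_, ?_⟩
      · have : (0 : ℝ) < t := by exact_mod_cast ht1
        positivity
      · rw [div_le_iff₀ hs]
        exact le_trans (by exact_mod_cast ht2) hn2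
      · rw [Prod.mk.injEq, ← hcdef, ← hsdef]
        constructor
        · rw [hv]; field_simp; ring
        · field_simp

/-- In a horizontal direction the window lies in row 0 and reads about `τ` initial coordinates
directly. -/
lemma exists_le_separatedNumber_of_sin_eq_zero (hp : p.Prime) (hk : 1 ≤ k)
    {a : Nbhd r → ZMod (p ^ k)} (L R : ℤ) {θ : ℝ} (hs : Real.sin θ = 0) {ε : ℝ} (hε : ε ≤ 1) :
    ∃ (w₀ : ℕ) (C τ₀ : ℝ), ∀ w : ℕ, w₀ ≤ w → ∀ τ : ℝ, τ₀ ≤ τ → ∃ N : ℕ,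
      τ * (max 0 (Real.cos θ + R * Real.sin θ) +
        max 0 (-(Real.cos θ + L * Real.sin θ))) - C ≤ N ∧
      (((p ^ k) ^ N : ℕ) : ℕ∞) ≤
        separatedNumber (cellularAutomaton (linearRule a)) ε (window w τ θ) := by
  refine ⟨1, 1, 0, fun w hw τ hτ => ?_⟩
  have hw' : (0 : ℝ) < w := by exact_mod_cast hw
  have hB1 := Int.floor_le τ
  have hB2 := Int.lt_floor_add_one τ
  have hB0 : 0 ≤ ⌊τ⌋ := Int.floor_nonneg.2 hτ
  have hB : ((⌊τ⌋.toNat : ℤ) : ℝ) = ⌊τ⌋ := by rw [Int.toNat_of_nonneg hB0]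
  rw [Int.cast_natCast] at hB
  rcases Real.sin_eq_zero_iff_cos_eq.1 hs with hc | hc
  · refine ⟨(Finset.Icc 1 ⌊τ⌋).card, ?_, le_separatedNumber hp hk hε _ fun z _ hsupp hW => ?_⟩
    · rw [Int.card_Icc, hs, hc]
      norm_num
      linarith
    · funext n
      by_cases hn : n ∈ Finset.Icc 1 ⌊τ⌋
      · obtain ⟨h1, h2⟩ := Finset.mem_Icc.1 hn
        have h1' : (1 : ℝ) ≤ n := by exact_mod_cast h1
        have h2' : (n : ℝ) ≤ ⌊τ⌋ := by exact_mod_cast h2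
        simpa using hW n 0 ⟨0, n, by linarith, hw', by linarith, by linarith, by simp [hs, hc]⟩
      · exact hsupp n hn
  · refine ⟨(Finset.Icc (-⌊τ⌋) (-1)).card, ?_, le_separatedNumber hp hk hε _ fun z _ hsupp hW => ?_⟩
    · rw [Int.card_Icc, hs, hc]
      norm_num
      linarith
    · funext n
      by_cases hn : n ∈ Finset.Icc (-⌊τ⌋) (-1)
      · obtain ⟨h1, h2⟩ := Finset.mem_Icc.1 hn
        have h1' : -(⌊τ⌋ : ℝ) ≤ n := by exact_mod_cast h1
        have h2' : (n : ℝ) ≤ -1 := by exact_mod_cast h2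
        simpa using hW n 0 ⟨0, -n, by linarith, hw', by linarith, by linarith, by simp [hs, hc]⟩
      · exact hsupp n hn

lemma log_natCast_pow (m N : ℕ) (hm : 0 < m) :
    ENNReal.log (((m ^ N : ℕ) : ℕ∞) : ENNReal) = ((N * Real.log m : ℝ) : EReal) := by
  rw [ENat.toENNReal_coe, ENNReal.log_pos_real (by simp; omega) (by simp)]
  simp

lemma tendsto_linear_div_atTop (h C b : ℝ) :
    Tendsto (fun τ : ℝ => (((τ * h + C) * b / τ : ℝ) : EReal)) atTop (𝓝 ((h * b : ℝ) : EReal)) := by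
  refine (continuous_coe_real_ereal.tendsto _).comp ?_
  have h1 : Tendsto (fun τ : ℝ => h * b + C * b * τ⁻¹) atTop (𝓝 (h * b + C * b * 0)) :=
    tendsto_const_nhds.add (tendsto_inv_atTop_zero.const_mul _)
  rw [mul_zero, add_zero] at h1
  refine h1.congr' ?_
  filter_upwards [eventually_gt_atTop 0] with τ hτ
  field_simp

/-- The directional entropy in all directions of the upper half plane, by one formula. -/
lemma hasDirectionalEntropy_max (hp : p.Prime) (hk : 1 ≤ k) {a : Nbhd r → ZMod (p ^ k)}
    (l ρ : Nbhd r) (hl0 : (l : ℤ) ≤ 0) (hρ0 : 0 ≤ (ρ : ℤ)) (hl : IsUnit (a l)) (hρ : IsUnit (a ρ))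
    (ha : ∀ j : Nbhd r, ((j : ℤ) < l ∨ (ρ : ℤ) < j) → ¬ IsUnit (a j)) {θ : ℝ}
    (hθ : θ ∈ Set.Icc 0 Real.pi) :
    HasDirectionalEntropy (cellularAutomaton (linearRule a)) θ
      ((max 0 (Real.cos θ + (ρ : ℤ) * Real.sin θ) +
        max 0 (-(Real.cos θ + (l : ℤ) * Real.sin θ))) * (k * Real.log p)) := by
  have hlog : (0 : ℝ) ≤ Real.log ((p ^ k : ℕ) : ℝ) := Real.log_natCast_nonneg _
  have hlogk : Real.log ((p ^ k : ℕ) : ℝ) = k * Real.log p := by push_cast; rw [Real.log_pow]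
  rw [← hlogk]
  set h := max 0 (Real.cos θ + (ρ : ℤ) * Real.sin θ) +
        max 0 (-(Real.cos θ + (l : ℤ) * Real.sin θ)) with hh
  -- For `0 < ε ≤ 1` the value at scale `ε` already equals the limit.
  refine tendsto_const_nhds.congr' ?_
  filter_upwards [Ioc_mem_nhdsGT zero_lt_one] with ε hε
  obtain ⟨C, hC⟩ := separatedNumber_le hp hk hl0 hρ0 ha θ hε.1
  have hlow : ∃ (w₀ : ℕ) (C τ₀ : ℝ), ∀ w : ℕ, w₀ ≤ w → ∀ τ : ℝ, τ₀ ≤ τ → ∃ N : ℕ,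
      τ * h - C ≤ N ∧ (((p ^ k) ^ N : ℕ) : ℕ∞) ≤
        separatedNumber (cellularAutomaton (linearRule a)) ε (window w τ θ) := by
    rcases (Real.sin_nonneg_of_mem_Icc hθ).eq_or_lt with hs | hs
    · exact exists_le_separatedNumber_of_sin_eq_zero hp hk _ _ hs.symm hε.2
    · exact exists_le_separatedNumber_of_sin_pos hp hk l ρ hl hρ ha hs hε.2
  obtain ⟨w₀, C', τ₀, hlow⟩ := hlow
  have hlim : ∀ w : ℕ, w₀ ≤ w → limsup (fun τ : ℝ =>
      ENNReal.log (separatedNumber (cellularAutomaton (linearRule a)) ε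
        (window w τ θ) : ENNReal) / (τ : EReal)) atTop =
      ((h * Real.log ((p ^ k : ℕ) : ℝ) : ℝ) : EReal) := by
    intro w hw
    refine Tendsto.limsup_eq (tendsto_of_tendsto_of_tendsto_of_le_of_le'
      (tendsto_linear_div_atTop h (-C') _) (tendsto_linear_div_atTop h (2 * w + C) _) ?_ ?_)
    · filter_upwards [eventually_ge_atTop τ₀, eventually_gt_atTop 0] with τ hτ hτ0
      obtain ⟨N, hN1, hN2⟩ := hlow w hw τ hτ
      have h1 := ENNReal.log_monotone (ENat.toENNReal_mono hN2)
      rw [log_natCast_pow _ _ (pow_pos hp.pos k)] at h1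
      refine le_trans ?_ (EReal.div_le_div_right_of_nonneg (EReal.coe_nonneg.2 hτ0.le) h1)
      rw [← EReal.coe_div, EReal.coe_le_coe_iff]
      gcongr
      linarith
    · filter_upwards [eventually_gt_atTop 0] with τ hτ0
      obtain ⟨N, hN1, hN2⟩ := hC w τ hτ0.le
      have h1 := ENNReal.log_monotone (ENat.toENNReal_mono hN2)
      rw [log_natCast_pow _ _ (pow_pos hp.pos k)] at h1
      refine le_trans (EReal.div_le_div_right_of_nonneg (EReal.coe_nonneg.2 hτ0.le) h1) ?_
      rw [← EReal.coe_div, EReal.coe_le_coe_iff]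
      gcongr
      linarith
  unfold directionalEntropyAtScale
  refine (Tendsto.limsup_eq (tendsto_const_nhds.congr' ?_)).symm
  filter_upwards [eventually_ge_atTop w₀] with w hw
  exact (hlim w hw).symm

lemma arccot_mem_Ioo (x : ℝ) : arccot x ∈ Set.Ioo 0 Real.pi := by
  have h1 := Real.arctan_lt_pi_div_two x
  have h2 := Real.neg_pi_div_two_lt_arctan x
  unfold arccot
  constructor <;> linarith

/-- The phase form shows that on `[0, π]` the sign changes only at `π / 2 + arctan x = arccot (-x)`.
-/
lemma cos_add_mul_sin_eq (x θ : ℝ) :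
    Real.cos θ + x * Real.sin θ = Real.cos (θ - Real.arctan x) / Real.cos (Real.arctan x) := by
  have h := (Real.cos_arctan_pos x).ne'
  rw [Real.cos_sub, eq_div_iff h]
  have : Real.sin (Real.arctan x) = x * Real.cos (Real.arctan x) := by
    rw [← Real.tan_mul_cos h, Real.tan_arctan]
  rw [this]; ring

lemma cos_add_mul_sin_nonneg {x θ : ℝ} (h0 : 0 ≤ θ) (h : θ ≤ arccot (-x)) :
    0 ≤ Real.cos θ + x * Real.sin θ := by
  rw [cos_add_mul_sin_eq]
  rw [arccot, Real.arctan_neg] at h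
  have := Real.arctan_lt_pi_div_two x
  exact div_nonneg (Real.cos_nonneg_of_neg_pi_div_two_le_of_le (by linarith) (by linarith))
    (Real.cos_arctan_pos x).le

lemma cos_add_mul_sin_nonpos {x θ : ℝ} (hπ : θ ≤ Real.pi) (h : arccot (-x) ≤ θ) :
    Real.cos θ + x * Real.sin θ ≤ 0 := by
  rw [cos_add_mul_sin_eq]
  rw [arccot, Real.arctan_neg] at h
  have := Real.neg_pi_div_two_lt_arctan x
  exact div_nonpos_of_nonpos_of_nonneg
    (Real.cos_nonpos_of_pi_div_two_le_of_le (by linarith) (by linarith))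
    (Real.cos_arctan_pos x).le

end Entropy

theorem mainTheorem2 (p k r : ℕ) (hp : p.Prime) (hk : 1 ≤ k)
    (a : Nbhd r → ZMod (p ^ k))
    (hleft : ∃ i : Nbhd r, (i : ℤ) < 0 ∧ IsPermutativeIn (linearRule a) i)
    (hright : ∃ j : Nbhd r, 0 < (j : ℤ) ∧ IsPermutativeIn (linearRule a) j)
    (L R : ℤ) (hL : IsLeast (unitPositions p a) L) (hR : IsGreatest (unitPositions p a) R) :
    (∀ θ ∈ Set.Icc 0 (arccot (-(L : ℝ))),
      HasDirectionalEntropy (cellularAutomaton (linearRule a)) θ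
        (k * |Real.cos θ + R * Real.sin θ| * Real.log p)) ∧
    (∀ θ ∈ Set.Icc (arccot (-(L : ℝ))) (arccot (-(R : ℝ))),
      HasDirectionalEntropy (cellularAutomaton (linearRule a)) θ
        (k * |((R : ℝ) - L) * Real.sin θ| * Real.log p)) ∧
    (∀ θ ∈ Set.Icc (arccot (-(R : ℝ))) Real.pi,
      HasDirectionalEntropy (cellularAutomaton (linearRule a)) θ
        (k * |Real.cos θ + L * Real.sin θ| * Real.log p)) := by
  have hmem : ∀ i : Nbhd r, IsUnit (a i) → (i : ℤ) ∈ unitPositions p a := fun i hi =>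
    Or.inr ⟨i, rfl, (gcd_val_eq_one_iff_isUnit hp hk _).2 hi⟩
  have hL0 : L < 0 := by
    obtain ⟨i, hi, hperm⟩ := hleft
    exact (hL.2 (hmem i (isUnit_of_isPermutativeIn hperm))).trans_lt hi
  have hR0 : 0 < R := by
    obtain ⟨j, hj, hperm⟩ := hright
    exact hj.trans_le (hR.2 (hmem j (isUnit_of_isPermutativeIn hperm)))
  -- Two-sided permutativity gives `L < 0 < R`, so neither extreme is the adjoined 0 and both carry
  -- unit coefficients.
  obtain ⟨l, rfl, hl⟩ := hL.1.resolve_left fun h => hL0.ne h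
  obtain ⟨ρ, rfl, hρ⟩ := hR.1.resolve_left fun h => hR0.ne' h
  rw [gcd_val_eq_one_iff_isUnit hp hk] at hl hρ
  have ha : ∀ j : Nbhd r, ((j : ℤ) < l ∨ (ρ : ℤ) < j) → ¬ IsUnit (a j) := fun j hj hu =>
    hj.elim (fun h => h.not_ge (hL.2 (hmem j hu))) fun h => h.not_ge (hR.2 (hmem j hu))
  have hent := fun {θ : ℝ} (hθ : θ ∈ Set.Icc 0 Real.pi) =>
    hasDirectionalEntropy_max hp hk l ρ hL0.le hR0.le hl hρ ha hθ
  have hlρ : ((l : ℤ) : ℝ) ≤ (ρ : ℤ) := by exact_mod_cast (hL0.trans hR0).le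
  have hle : ∀ {θ : ℝ}, θ ∈ Set.Icc 0 Real.pi →
      Real.cos θ + (l : ℤ) * Real.sin θ ≤ Real.cos θ + (ρ : ℤ) * Real.sin θ := fun hθ => by
    have := mul_le_mul_of_nonneg_right hlρ (Real.sin_nonneg_of_mem_Icc hθ)
    linarith
  have hl' := arccot_mem_Ioo (-((l : ℤ) : ℝ))
  have hρ' := arccot_mem_Ioo (-((ρ : ℤ) : ℝ))
  refine ⟨fun θ hθ => ?_, fun θ hθ => ?_, fun θ hθ => ?_⟩
  · have hθ' : θ ∈ Set.Icc 0 Real.pi := ⟨hθ.1, hθ.2.trans hl'.2.le⟩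
    have h1 := cos_add_mul_sin_nonneg hθ.1 hθ.2
    have h2 := h1.trans (hle hθ')
    convert hent hθ' using 1
    rw [max_eq_right h2, max_eq_left (by linarith), abs_of_nonneg h2]
    ring
  · have hθ' : θ ∈ Set.Icc 0 Real.pi := ⟨hl'.1.le.trans hθ.1, hθ.2.trans hρ'.2.le⟩
    have h1 := cos_add_mul_sin_nonpos hθ'.2 hθ.1
    have h2 := cos_add_mul_sin_nonneg hθ'.1 hθ.2
    convert hent hθ' using 1
    rw [max_eq_right h2, max_eq_right (by linarith), abs_of_nonneg (by linarith [hle hθ'])]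
    ring
  · have hθ' : θ ∈ Set.Icc 0 Real.pi := ⟨hρ'.1.le.trans hθ.1, hθ.2⟩
    have h2 := cos_add_mul_sin_nonpos hθ'.2 hθ.1
    have h1 := (hle hθ').trans h2
    convert hent hθ' using 1
    rw [max_eq_left h2, max_eq_right (by linarith), abs_of_nonpos h1]
    ring
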